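/- Let $\nu$ be a probability measure on $[0,1]$. Let $\theta_1,\theta_2,\dots$ be i.i.d. random variables with distribution $\nu$ and, conditionally given $(\theta_j)_{j\ge1}$, let $G_\infty$ be the infinite random graph on $\{1,2,\dots\}$ in which each edge $\{i,j\}$ appears with probability $\theta_{\max\{i,j\}}$, all edges appearing (conditionally) independently. Let $G_n$ be the subgraph of $G_\infty$ induced by $\{1,\dots,n\}$. Let $\lambda$ be Lebesgue measure on $[0,1]$, and define the symmetric kernel $W$ on the probability space $([0,1]^2,\nu\times\lambda)$ by $$W\bigl((s_1,t_1),(s_2,t_2)\bigr)=\begin{cases}s_2,& t_1<t_2,\\ s_1,& t_1>t_2,\\ 0,& t_1=t_2.\end{cases}$$ For finite graphs $F,G$ let $t(F,G)$ be the probability that a uniformly random map $V(F)\to V(G)$ is a graph homomorphism. A graph limit $\Gamma$ is identified with a family $(t(F,\Gamma))_F$ that is the limit of $(t(F,H_n))_F$, for every $F$, for some finite graphs $H_n$ with $|H_n|\to\infty$; the space of all (unlabelled, non-empty) finite graphs and graph limits carries the topology given by the coordinates $t(F,\cdot)$ and $1/|\cdot|$ (with $1/|\Gamma|=0$). Then there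 is a graph limit $\Gamma_\nu$ represented by $W$ on $([0,1]^2,\nu\times\lambda)$, that is, for every finite graph $F$ with vertices $1,\dots,k$, $$t(F,\Gamma_\nu)=\int_{([0,1]^2)^k}\ \prod_{\{i,j\}\in E(F)}W(x_i,x_j)\ d(\nu\times\lambda)^{k}(x_1,\dots,x_k),$$ and $G_n\to\Gamma_\nu$ in probability as $n\to\infty$: for every neighbourhood $U$ of $\Gamma_\nu$ in this space, $\mathbb P(G_n\notin U)\to0$. -/

import Mathlib

open MeasureTheory ProbabilityTheory Filter Topology
open scoped unitInterval

noncomputable section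

/-! ### Finite graphs and homomorphism densities -/

/-- The finite graphs: simple graphs on the vertex set `Fin (n + 1)`, `n = 0, 1, 2, …`.
Every finite graph with at least one vertex is isomorphic to one of these. -/
abbrev FinGraph : Type := Σ n : ℕ, SimpleGraph (Fin (n + 1))

/-- The number of vertices `|G|`. -/
def FinGraph.order (G : FinGraph) : ℕ := G.1 + 1

/-- `t(F, G)`: the probability that a uniformly random map `V(F) → V(G)` is a graph homomorphism,
that is, the number of homomorphisms divided by the number of maps. -/
def homDensity (F G : FinGraph) : ℝ :=
  (Nat.card (F.2 →g G.2) : ℝ) / (Nat.card (Fin F.order → Fin G.order) : ℝ)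

/-! ### The space of unlabelled graphs and graph limits -/

/-- The coordinates `((t(F, G))_F, 1 / |G|)` of a finite graph. They depend only on the isomorphism
class of `G`, and they determine it. -/
def graphPoint (G : FinGraph) : (FinGraph → ℝ) × ℝ :=
  (fun F => homDensity F G, 1 / (G.order : ℝ))

/-- The compact metrizable space of all (unlabelled) graphs and all graph limits: the closure of the
set of finite graphs in the product `(∏_F ℝ) × ℝ`, with the subspace topology. -/
abbrev GraphSpace : Type := closure (Set.range graphPoint)

/-- A finite graph as a point of the space of graphs and graph limits. -/
def FinGraph.toGraphSpace (G : FinGraph) : GraphSpace :=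
  ⟨graphPoint G, subset_closure (Set.mem_range_self G)⟩

/-- The graph limits: the points of `GraphSpace` with last coordinate `1 / |G| = 0`. As the space is
metrizable, these are the families `(t_F)_F` for which there are graphs `G_n` with `|G_n| → ∞` and
`t(F, G_n) → t_F` for every `F`. -/
abbrev GraphLimit : Type := {x : GraphSpace // x.1.2 = 0}

/-- `t(F, Γ)` for a graph limit `Γ`. A graph limit is determined by these numbers. -/
def GraphLimit.density (Γ : GraphLimit) (F : FinGraph) : ℝ := Γ.1.1.1 F

/-- Convergence in probability `G_n → Γ` of random graphs to a (deterministic) graph limit, in the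
space of graphs and graph limits: for every neighbourhood `U` of `Γ`, `P(G_n ∉ U) → 0`. -/
def ConvergesInProbability {Ω : Type*} [MeasurableSpace Ω] (P : Measure Ω)
    (G : ℕ → Ω → FinGraph) (Γ : GraphLimit) : Prop :=
  ∀ U ∈ 𝓝 (Γ : GraphSpace),
    Tendsto (fun n => P {ω | (G n ω).toGraphSpace ∉ U}) atTop (𝓝 0)

/-! ### Kernels -/

/-- A kernel (graphon) on a measurable space `S`: a measurable symmetric function
`S × S → [0, 1]`. -/
structure GraphKernel (S : Type*) [MeasurableSpace S] where
  /-- The underlying function. -/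
  toFun : S → S → I
  measurable : Measurable (fun p : S × S => toFun p.1 p.2)
  symm : ∀ x y, toFun x y = toFun y x

open Classical in
/-- `t(F, W) = ∫_{S^{V(F)}} ∏_{ij ∈ E(F)} W(x_i, x_j) dμ(x_1) ⋯ dμ(x_k)`, where each edge of `F` is
counted once, as a pair `i < j`. -/
def GraphKernel.density {S : Type*} [MeasurableSpace S] (W : GraphKernel S) (μ : Measure S)
    (F : FinGraph) : ℝ :=
  ∫ x : Fin F.order → S,
    ∏ e : Fin F.order × Fin F.order with e.1 < e.2 ∧ F.2.Adj e.1 e.2,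
      (W.toFun (x e.1) (x e.2) : ℝ) ∂(Measure.pi fun _ => μ)

/-- `Γ = Γ_W`: the graph limit `Γ` is represented by the kernel `W` on `(S, μ)`, that is,
`t(F, Γ) = t(F, W)` for every graph `F`. -/
def GraphLimit.IsRepresentedBy (Γ : GraphLimit) {S : Type*} [MeasurableSpace S]
    (W : GraphKernel S) (μ : Measure S) : Prop :=
  ∀ F : FinGraph, Γ.density F = W.density μ F

/-- The kernel `W((s₁, t₁), (s₂, t₂))` on `[0, 1]²`, equal to `s₂` if `t₁ < t₂`, to `s₁` if
`t₁ > t₂`, and to `0` if `t₁ = t₂`. -/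
def maxKernel : GraphKernel (I × I) where
  toFun x y := if x.2 < y.2 then y.1 else if y.2 < x.2 then x.1 else 0
  measurable := by
    refine Measurable.ite (measurableSet_lt (by fun_prop) (by fun_prop)) (by fun_prop) ?_
    exact Measurable.ite (measurableSet_lt (by fun_prop) (by fun_prop)) (by fun_prop) (by fun_prop)
  symm x y := by
    rcases lt_trichotomy x.2 y.2 with h | h | h
    · simp [h, not_lt.2 h.le]
    · simp [h]
    · simp [h, not_lt.2 h.le]

/-! ### The random graphs -/

/-- The infinite random graph `G` (vertices `0, 1, 2, …`) constructed from a probability measure `ν`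
on `[0, 1]`: the `θ i` are i.i.d. with law `ν` and, conditionally on the sequence `θ`, the edges
`{i, j}` appear independently with probabilities `θ (max i j)`. Conditional independence is
expressed by `P(all edges of s are present | σ(θ)) = ∏_{ij ∈ s} θ (max i j)` a.s., for every finite
set `s` of pairs `i < j`; one-element sets give the conditional edge probabilities. -/
structure IsMaxThetaGraph {Ω : Type*} [MeasurableSpace Ω] (P : Measure Ω) (ν : Measure I)
    (θ : ℕ → Ω → I) (G : Ω → SimpleGraph ℕ) : Prop where
  measurable_theta : ∀ i, Measurable (θ i)
  law_theta : ∀ i, P.map (θ i) = ν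
  indep_theta : iIndepFun θ P
  measurableSet_adj : ∀ i j, MeasurableSet {ω | (G ω).Adj i j}
  condProb_edges : ∀ s : Finset (ℕ × ℕ), (∀ e ∈ s, e.1 < e.2) →
    P⟦{ω | ∀ e ∈ s, (G ω).Adj e.1 e.2} | MeasurableSpace.comap (fun ω i => θ i ω) inferInstance⟧
      =ᵐ[P] fun ω => ∏ e ∈ s, (θ (max e.1 e.2) ω : ℝ)

/-- The restriction of an infinite graph to its first `n + 1` vertices. -/
def initialGraph (G : SimpleGraph ℕ) (n : ℕ) : FinGraph :=
  ⟨n, G.comap fun i : Fin (n + 1) => (i : ℕ)⟩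

end

/-! ### The uniform grid of the unit interval -/

/-! The proof is a second moment argument for each fixed `F`. A uniform map from `V` to the vertices
of `G_n` is obtained by rounding independent uniform points `t v` to a grid (`integral_gridCell`).
Almost surely these points are distinct, so for large `n` the rounded values are distinct and
ordered like the `t v`. The probability that an injective map preserves the edges depends only on
this order, and equals the integral of the kernel product over the first coordinates with `t` fixed
(`IsMaxThetaGraph.measureReal_forall_adj`). Dominated convergence then gives convergence of the mean
density.

The square of a density is the density of two disjoint copies, so the second moment converges to the
square of the limit, and Chebyshev yields convergence in probability. For this, edge sets live on an
arbitrary finite type `V`, which may be replaced by `V ⊕ V`. Writing convergence in probability as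
convergence along a filter reduces the product topology to its coordinates, and also produces the
limit point. -/

/-- The index of the cell of the uniform partition of `[0, 1]` into `n + 1` intervals containing
a given point. -/
noncomputable def gridCell (n : ℕ) (t : I) : Fin (n + 1) :=
  ⟨min ⌊((n : ℝ) + 1) * t⌋₊ n, Nat.lt_succ_of_le (min_le_right _ _)⟩

@[fun_prop]
theorem measurable_gridCell (n : ℕ) : Measurable (gridCell n) := by
  have h : Measurable fun t : I => min ⌊((n : ℝ) + 1) * t⌋₊ n :=
    ((by fun_prop : Measurable fun t : I => ((n : ℝ) + 1) * t).nat_floor).min measurable_const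
  refine measurable_to_countable' fun j => ?_
  have : gridCell n ⁻¹' {j} = (fun t : I => min ⌊((n : ℝ) + 1) * t⌋₊ n) ⁻¹' {(j : ℕ)} := by
    ext t
    simp [gridCell, Fin.ext_iff]
  rw [this]
  exact h (measurableSet_singleton _)

theorem gridCell_val_of_lt {t : I} (n : ℕ) (ht : (t : ℝ) < 1) :
    (gridCell n t : ℕ) = ⌊((n : ℝ) + 1) * t⌋₊ := by
  have h0 : 0 ≤ ((n : ℝ) + 1) * t := mul_nonneg (by positivity) t.2.1
  have : ⌊((n : ℝ) + 1) * t⌋₊ < n + 1 := by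
    rw [Nat.floor_lt h0]
    push_cast
    nlinarith [(by positivity : (0 : ℝ) < n + 1)]
  exact min_eq_left (by omega)

theorem ae_lt_one : ∀ᵐ t : I, (t : ℝ) < 1 := by
  have : ∀ᵐ t : I, t ≠ 1 := by simp [ae_iff]
  filter_upwards [this] with t ht
  exact lt_of_le_of_ne t.2.2 fun h => ht (Subtype.ext h)

theorem measureReal_gridCell_preimage (n : ℕ) (j : Fin (n + 1)) :
    (volume : Measure I).real (gridCell n ⁻¹' {j}) = 1 / ((n : ℝ) + 1) := by
  have hn : (0 : ℝ) < n + 1 := by positivity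
  have hj : (j : ℝ) + 1 ≤ n + 1 := by exact_mod_cast j.2
  have ha : (j : ℝ) / (n + 1) ∈ I :=
    ⟨by positivity, by rw [div_le_one hn]; linarith⟩
  have hb : ((j : ℝ) + 1) / (n + 1) ∈ I :=
    ⟨by positivity, by rw [div_le_one hn]; linarith⟩
  -- The two sets can differ only at `t = 1`, which the truncation by `min` puts in the last cell.
  have hae : gridCell n ⁻¹' {j} =ᵐ[volume] Set.Ico (⟨_, ha⟩ : I) ⟨_, hb⟩ := by
    filter_upwards [ae_lt_one] with t ht
    have h0 : 0 ≤ ((n : ℝ) + 1) * t := mul_nonneg hn.le t.2.1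
    refine propext ?_
    change gridCell n t = j ↔ (j : ℝ) / (n + 1) ≤ t ∧ (t : ℝ) < ((j : ℝ) + 1) / (n + 1)
    rw [Fin.ext_iff, gridCell_val_of_lt n ht, Nat.floor_eq_iff h0, div_le_iff₀ hn, lt_div_iff₀ hn,
      mul_comm (t : ℝ)]
  rw [measureReal_congr hae, measureReal_def, unitInterval.volume_Ico, ENNReal.toReal_ofReal]
  · simp only []
    ring
  · simp only [sub_nonneg]
    gcongr
    linarith

/-- The cells have equal mass, so rounding independent uniform points gives a uniform map. Averages
over maps become integrals over a space that does not depend on `n`. -/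
theorem integral_gridCell {V : Type*} [Fintype V] [DecidableEq V] (n : ℕ) (f : (V → Fin (n + 1)) → ℝ) :
    ∫ t : V → I, f (fun v => gridCell n (t v)) ∂(Measure.pi fun _ => volume) =
      (∑ φ, f φ) / ((n : ℝ) + 1) ^ Fintype.card V := by
  have hm := measurable_gridCell n
  have hmap := Measure.pi_map_pi (μ := fun _ : V => (volume : Measure I))
    (f := fun _ => gridCell n) (fun _ => hm.aemeasurable)
  have : IsProbabilityMeasure ((volume : Measure I).map (gridCell n)) :=
    Measure.isProbabilityMeasure_map hm.aemeasurable
  rw [← integral_map (φ := fun (t : V → I) v => gridCell n (t v)) (f := f)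
    (measurable_pi_lambda _ fun v => hm.comp (measurable_pi_apply v)).aemeasurable
    (by exact (measurable_of_finite f).aestronglyMeasurable), hmap,
    integral_fintype (by exact Integrable.of_finite), Finset.sum_div]
  refine Finset.sum_congr rfl fun φ _ => ?_
  have (j : Fin (n + 1)) : ((volume : Measure I).map (gridCell n)).real {j} = 1 / ((n : ℝ) + 1) := by
    rw [map_measureReal_apply hm (measurableSet_singleton j), measureReal_gridCell_preimage]
  simp only [measureReal_def] at this ⊢
  rw [Measure.pi_singleton, ENNReal.toReal_prod]
  simp [this, div_eq_inv_mul]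

/-- It suffices that `(n + 1) * (t - s) ≥ 1`, since the two floors then differ. -/
theorem eventually_gridCell_lt {s t : I} (hs : (s : ℝ) < 1) (ht : (t : ℝ) < 1) (h : s < t) :
    ∀ᶠ n in atTop, (gridCell n s : ℕ) < gridCell n t := by
  have h' : (0 : ℝ) < t - s := sub_pos.2 h
  have hlim : Tendsto (fun n : ℕ => ((n : ℝ) + 1) * (t - s)) atTop atTop :=
    (tendsto_atTop_add_const_right _ _ tendsto_natCast_atTop_atTop).atTop_mul_const h'
  filter_upwards [hlim.eventually_ge_atTop 1] with n hn
  rw [gridCell_val_of_lt n hs, gridCell_val_of_lt n ht, Nat.lt_iff_add_one_le,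
    Nat.le_floor_iff (mul_nonneg (by positivity) t.2.1)]
  push_cast
  have := Nat.floor_le (mul_nonneg (by positivity) s.2.1 : 0 ≤ ((n : ℝ) + 1) * s)
  linarith

theorem ae_pairwise_ne (V : Type*) [Fintype V] :
    ∀ᵐ t : V → I ∂(Measure.pi fun _ => volume), ∀ v w, v ≠ w → t v ≠ t w := by
  refine ae_all_iff.2 fun v => ae_all_iff.2 fun w => ?_
  by_cases hvw : v = w
  · simp [hvw]
  have hind : IndepFun (fun t : V → I => t v) (fun t => t w) (Measure.pi fun _ => volume) :=
    (iIndepFun_pi (X := fun _ : V => (id : I → I)) (μ := fun _ => volume)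
      fun _ => aemeasurable_id).indepFun hvw
  have hmap := hind.map_prod_eq_prod_map_map (measurable_pi_apply v).aemeasurable
    (measurable_pi_apply w).aemeasurable
  rw [(measurePreserving_eval (fun _ : V => (volume : Measure I)) v).map_eq,
    (measurePreserving_eval (fun _ : V => (volume : Measure I)) w).map_eq] at hmap
  have hd : ∀ᵐ p : I × I ∂(volume.prod volume), p.1 ≠ p.2 := by
    rw [ae_iff, Measure.measure_prod_null
      (by simpa using measurableSet_eq_fun measurable_fst measurable_snd)]
    refine .of_forall fun x => ?_
    have : Prod.mk x ⁻¹' {p : I × I | ¬ p.1 ≠ p.2} = {x} := by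
      ext y
      simp [eq_comm]
    exact (congrArg volume this).trans (measure_singleton x)
  rw [← hmap] at hd
  filter_upwards [ae_of_ae_map (by fun_prop) hd] with t ht _ using ht
/-! ### Edge sets, and the proportion of maps preserving them -/

section Moments

variable {Ω : Type*} [MeasurableSpace Ω] {P : Measure Ω} {ν : Measure I}
  {θ : ℕ → Ω → I} {G : Ω → SimpleGraph ℕ} {V : Type*}

open Classical in
/-- The proportion of maps `V → {0, …, n}` that send all pairs of `E` to edges of `H`. -/
noncomputable def mapDensity [Fintype V] [DecidableEq V] (E : Finset (V × V)) (H : SimpleGraph ℕ) (n : ℕ) : ℝ :=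
  (∑ φ : V → Fin (n + 1), if ∀ e ∈ E, H.Adj (φ e.1) (φ e.2) then (1 : ℝ) else 0) /
    ((n : ℝ) + 1) ^ Fintype.card V

/-- The density `∫ ∏_{ij ∈ E} W(x_i, x_j)` of a set `E` of pairs in the kernel `maxKernel`. -/
noncomputable def maxKernelDensity [Fintype V] (ν : Measure I) (E : Finset (V × V)) : ℝ :=
  ∫ x : V → I × I, ∏ e ∈ E, (maxKernel.toFun (x e.1) (x e.2) : ℝ)
    ∂(Measure.pi fun _ => ν.prod volume)

theorem mapDensity_mem_Icc [Fintype V] [DecidableEq V] (E : Finset (V × V)) (H : SimpleGraph ℕ) (n : ℕ) :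
    mapDensity E H n ∈ Set.Icc (0 : ℝ) 1 := by
  classical
  have hpos : (0 : ℝ) < ((n : ℝ) + 1) ^ Fintype.card V := by positivity
  refine ⟨div_nonneg (Finset.sum_nonneg fun φ _ => by split_ifs <;> norm_num) hpos.le, ?_⟩
  rw [mapDensity, div_le_one hpos]
  calc _ ≤ ∑ φ : V → Fin (n + 1), (1 : ℝ) :=
        Finset.sum_le_sum fun φ _ => by split_ifs <;> norm_num
    _ = _ := by simp

theorem IsMaxThetaGraph.measurableSet_forall_adj (hG : IsMaxThetaGraph P ν θ G)
    (E : Finset (V × V)) (φ : V → ℕ) :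
    MeasurableSet {ω | ∀ e ∈ E, (G ω).Adj (φ e.1) (φ e.2)} := by
  have : {ω | ∀ e ∈ E, (G ω).Adj (φ e.1) (φ e.2)} =
      ⋂ e ∈ E, {ω | (G ω).Adj (φ e.1) (φ e.2)} := by
    ext ω
    simp
  rw [this]
  exact E.measurableSet_biInter fun e _ => hG.measurableSet_adj _ _

theorem IsMaxThetaGraph.measurable_mapDensity [Fintype V] [DecidableEq V] (hG : IsMaxThetaGraph P ν θ G)
    (E : Finset (V × V)) (n : ℕ) : Measurable fun ω => mapDensity E (G ω) n := by
  classical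
  unfold mapDensity
  refine Measurable.div_const (Finset.measurable_sum _ fun φ _ => ?_) _
  exact Measurable.ite (hG.measurableSet_forall_adj E fun v => (φ v : ℕ))
    measurable_const measurable_const

theorem measurable_prod_maxKernel (E : Finset (V × V)) :
    Measurable fun x : V → I × I => ∏ e ∈ E, (maxKernel.toFun (x e.1) (x e.2) : ℝ) := by
  refine Finset.measurable_prod _ fun e _ => measurable_subtype_coe.comp ?_
  exact maxKernel.measurable.comp
    (f := fun x : V → I × I => (x e.1, x e.2)) (by fun_prop)

theorem norm_prod_maxKernel_le (E : Finset (V × V)) (x : V → I × I) :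
    ‖∏ e ∈ E, (maxKernel.toFun (x e.1) (x e.2) : ℝ)‖ ≤ 1 := by
  rw [Real.norm_of_nonneg (Finset.prod_nonneg fun e _ => (maxKernel.toFun _ _).2.1)]
  exact Finset.prod_le_one (fun e _ => (maxKernel.toFun _ _).2.1)
    fun e _ => (maxKernel.toFun _ _).2.2

/-- The probability that an injective map preserves a set of edges depends only on the order of
its values, which may be prescribed by points of `[0, 1]`. -/
theorem IsMaxThetaGraph.measureReal_forall_adj [Fintype V] [IsProbabilityMeasure P]
    (hG : IsMaxThetaGraph P ν θ G) (E : Finset (V × V)) (hE : ∀ e ∈ E, e.swap ∉ E)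
    (φ : V → ℕ) (hφ : Function.Injective φ) (t : V → I) (ht : ∀ v w, t v < t w ↔ φ v < φ w) :
    P.real {ω | ∀ e ∈ E, (G ω).Adj (φ e.1) (φ e.2)} =
      ∫ s : V → I, ∏ e ∈ E, (maxKernel.toFun (s e.1, t e.1) (s e.2, t e.2) : ℝ)
        ∂(Measure.pi fun _ => ν) := by
  classical
  have hne : ∀ e ∈ E, e.1 ≠ e.2 := fun e he h =>
    hE e he (by rwa [show e.swap = e from Prod.ext h.symm h])
  -- Each image pair is put in increasing order, as `condProb_edges` requires. Since `E` contains no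
  -- pair together with its swap, no edge arises twice, so no factor `θ` is repeated in the product.
  let g : V × V → ℕ × ℕ := fun e => (min (φ e.1) (φ e.2), max (φ e.1) (φ e.2))
  have hg : Set.InjOn g E := by
    rintro ⟨a, b⟩ hab ⟨c, d⟩ hcd h
    simp only [g, Prod.mk.injEq] at h
    have : φ a = φ c ∧ φ b = φ d ∨ φ a = φ d ∧ φ b = φ c := by omega
    rcases this with h | h
    · exact Prod.ext (hφ h.1) (hφ h.2)
    · obtain ⟨rfl, rfl⟩ : a = d ∧ b = c := ⟨hφ h.1, hφ h.2⟩
      exact absurd hcd (hE _ hab)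
  have hlt : ∀ e ∈ E.image g, e.1 < e.2 := by
    intro e he
    obtain ⟨e, h, rfl⟩ := Finset.mem_image.1 he
    have := hφ.ne (hne e h)
    simp only [g]
    omega
  have hset : {ω | ∀ e ∈ E, (G ω).Adj (φ e.1) (φ e.2)} =
      {ω | ∀ e ∈ E.image g, (G ω).Adj e.1 e.2} := by
    ext ω
    simp only [Set.mem_ofPred_eq, Finset.forall_mem_image, g]
    refine forall₂_congr fun e _ => ?_
    rcases le_total (φ e.1) (φ e.2) with h | h
    · simp [h]
    · simp [h, SimpleGraph.adj_comm]
  have hmeas := hG.measurableSet_forall_adj E φ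
  have hθ : Measurable fun ω i => θ i ω := measurable_pi_lambda _ hG.measurable_theta
  have hlaw : P.map (fun ω v => θ (φ v) ω) = Measure.pi fun _ : V => ν := by
    rw [(iIndepFun_iff_map_fun_eq_pi_map fun v => (hG.measurable_theta (φ v)).aemeasurable).1
      (hG.indep_theta.precomp hφ)]
    simp [hG.law_theta]
  have hF : Measurable fun s : V → I =>
      ∏ e ∈ E, (maxKernel.toFun (s e.1, t e.1) (s e.2, t e.2) : ℝ) :=
    (measurable_prod_maxKernel E).comp
      (by fun_prop : Measurable fun (s : V → I) v => (s v, t v))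
  rw [← hlaw, integral_map (by
    exact (measurable_pi_lambda _ fun v => hG.measurable_theta (φ v)).aemeasurable)
    hF.aestronglyMeasurable]
  rw [hset] at hmeas ⊢
  calc _ = ∫ ω, {ω | ∀ e ∈ E.image g, (G ω).Adj e.1 e.2}.indicator (fun _ => (1 : ℝ)) ω ∂P := by
        rw [integral_indicator_const _ hmeas]
        simp
    _ = ∫ ω, ∏ e ∈ E.image g, (θ (max e.1 e.2) ω : ℝ) ∂P := by
        rw [← integral_condExp hθ.comap_le]
        exact integral_congr_ae (hG.condProb_edges _ hlt)
    _ = _ := by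
        refine integral_congr_ae (.of_forall fun ω => ?_)
        simp only
        rw [Finset.prod_image hg]
        refine Finset.prod_congr rfl fun e he => ?_
        have h1 := hφ.ne (hne e he)
        simp only [g, maxKernel, ht]
        rcases lt_or_gt_of_ne h1 with h | h
        · simp [h, h.le]
        · simp [h, h.le, h.not_gt]

theorem IsMaxThetaGraph.integral_mapDensity [Fintype V] [DecidableEq V] [IsProbabilityMeasure P]
    (hG : IsMaxThetaGraph P ν θ G) (E : Finset (V × V)) (n : ℕ) :
    ∫ ω, mapDensity E (G ω) n ∂P =
      ∫ t : V → I, P.real {ω | ∀ e ∈ E, (G ω).Adj (gridCell n (t e.1)) (gridCell n (t e.2))}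
        ∂(Measure.pi fun _ => volume) := by
  classical
  rw [integral_gridCell n fun φ : V → Fin (n + 1) =>
    P.real {ω | ∀ e ∈ E, (G ω).Adj (φ e.1) (φ e.2)}]
  simp only [mapDensity]
  have hm (φ : V → Fin (n + 1)) := hG.measurableSet_forall_adj E fun v => (φ v : ℕ)
  have hi (φ : V → Fin (n + 1)) :
      (fun ω => if ∀ e ∈ E, (G ω).Adj (φ e.1) (φ e.2) then (1 : ℝ) else 0) =
        {ω | ∀ e ∈ E, (G ω).Adj (φ e.1) (φ e.2)}.indicator fun _ => (1 : ℝ) := by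
    ext ω
    simp [Set.indicator_apply]
  rw [integral_div, integral_finsetSum _ fun φ _ => by
    rw [hi]; exact (integrable_const _).indicator (hm φ)]
  congr 1
  refine Finset.sum_congr rfl fun φ _ => ?_
  rw [hi, integral_indicator_const _ (hm φ)]
  simp

/-- Fubini with `t` as the outer variable, so that the inner integral can be compared with an edge
probability at fixed `t`. -/
theorem maxKernelDensity_eq_integral_integral [Fintype V] [IsProbabilityMeasure ν]
    (E : Finset (V × V)) :
    maxKernelDensity ν E =
      ∫ t : V → I, ∫ s : V → I,
        ∏ e ∈ E, (maxKernel.toFun (s e.1, t e.1) (s e.2, t e.2) : ℝ)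
          ∂(Measure.pi fun _ => ν) ∂(Measure.pi fun _ => volume) := by
  have hmp := (measurePreserving_arrowProdEquivProdArrow I I V (fun _ => ν)
    (fun _ => volume)).symm
  have hm : Measurable fun p : (V → I) × (V → I) =>
      ∏ e ∈ E, (maxKernel.toFun (p.1 e.1, p.2 e.1) (p.1 e.2, p.2 e.2) : ℝ) :=
    (measurable_prod_maxKernel E).comp
      (by fun_prop : Measurable fun (p : (V → I) × (V → I)) v => (p.1 v, p.2 v))
  rw [maxKernelDensity, ← hmp.integral_comp']
  refine integral_prod_symm (fun p : (V → I) × (V → I) =>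
      ∏ e ∈ E, (maxKernel.toFun (p.1 e.1, p.2 e.1) (p.1 e.2, p.2 e.2) : ℝ)) ?_
  exact .of_bound hm.aestronglyMeasurable 1
    (.of_forall fun p => norm_prod_maxKernel_le E fun v => (p.1 v, p.2 v))

/-- For almost every `t` the integrand is eventually constant in `n`: once the grid separates the
coordinates of `t`, it equals the inner kernel integral. -/
theorem IsMaxThetaGraph.tendsto_integral_mapDensity [Fintype V] [DecidableEq V] [IsProbabilityMeasure P]
    [IsProbabilityMeasure ν] (hG : IsMaxThetaGraph P ν θ G) (E : Finset (V × V))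
    (hE : ∀ e ∈ E, e.swap ∉ E) :
    Tendsto (fun n => ∫ ω, mapDensity E (G ω) n ∂P) atTop (𝓝 (maxKernelDensity ν E)) := by
  simp only [hG.integral_mapDensity, maxKernelDensity_eq_integral_integral]
  refine tendsto_integral_of_dominated_convergence (fun _ => 1) (fun n => ?_)
    (integrable_const _) (fun n => .of_forall fun t => ?_) ?_
  · have := measurable_gridCell n
    exact ((measurable_of_countable fun φ : V → Fin (n + 1) =>
      P.real {ω | ∀ e ∈ E, (G ω).Adj (φ e.1) (φ e.2)}).comp
        (by fun_prop : Measurable fun (t : V → I) v => gridCell n (t v))).aestronglyMeasurable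
  · rw [Real.norm_of_nonneg measureReal_nonneg]
    exact measureReal_le_one
  have hone : ∀ᵐ t : V → I ∂(Measure.pi fun _ => volume), ∀ v, (t v : ℝ) < 1 :=
    ae_all_iff.2 fun v => (Measure.quasiMeasurePreserving_eval (fun _ : V => (volume : Measure I)) v).ae ae_lt_one
  filter_upwards [hone, ae_pairwise_ne V] with t ht hne
  have key : ∀ᶠ n in atTop, ∀ v w, t v < t w → (gridCell n (t v) : ℕ) < gridCell n (t w) :=
    eventually_all.2 fun v => eventually_all.2 fun w => eventually_imp_distrib_left.2 fun h =>
      eventually_gridCell_lt (ht v) (ht w) h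
  refine tendsto_const_nhds.congr' ?_
  filter_upwards [key] with n hn
  refine (hG.measureReal_forall_adj E hE (fun v => (gridCell n (t v) : ℕ)) ?_ t ?_).symm
  · intro v w h
    by_contra hvw
    rcases lt_or_gt_of_ne (hne v w hvw) with h' | h'
    · exact (hn _ _ h').ne h
    · exact (hn _ _ h').ne' h
  · refine fun v w => ⟨hn v w, fun h => ?_⟩
    by_contra hvw
    rcases lt_or_eq_of_le (not_lt.1 hvw) with h' | h'
    · exact (hn _ _ h').not_gt h
    · simp [h'] at h

/-! ### The second moment -/

/-- Two disjoint copies of a set of pairs. -/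
def doubleEdges (E : Finset (V × V)) : Finset ((V ⊕ V) × (V ⊕ V)) :=
  (E.map (Function.Embedding.inl.prodMap Function.Embedding.inl)).disjUnion
    (E.map (Function.Embedding.inr.prodMap Function.Embedding.inr)) (by
      rw [Finset.disjoint_left]
      simp)

theorem swap_notMem_doubleEdges {E : Finset (V × V)} (hE : ∀ e ∈ E, e.swap ∉ E) :
    ∀ e ∈ doubleEdges E, e.swap ∉ doubleEdges E := by
  rintro ⟨a | a, b | b⟩ h <;> simp [doubleEdges] at h ⊢ <;> exact hE _ h

/-- A map from `V ⊕ V` is a pair of maps from `V`, and no pair of `doubleEdges E` joins the two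
copies. -/
theorem mapDensity_doubleEdges [Fintype V] [DecidableEq V] (E : Finset (V × V)) (H : SimpleGraph ℕ) (n : ℕ) :
    mapDensity (doubleEdges E) H n = mapDensity E H n ^ 2 := by
  classical
  rw [mapDensity, mapDensity, sq, div_mul_div_comm, ← pow_add, Fintype.card_sum,
    Finset.sum_mul_sum, ← Fintype.sum_prod_type',
    ← (Equiv.sumArrowEquivProdArrow V V (Fin (n + 1))).sum_comp]
  congr 1
  refine Finset.sum_congr rfl fun φ _ => ?_
  rw [ite_zero_mul_ite_zero, mul_one]
  refine if_congr ?_ rfl rfl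
  simp only [doubleEdges, Finset.mem_disjUnion, or_imp, forall_and, Finset.forall_mem_map]
  rfl

theorem maxKernelDensity_doubleEdges [Fintype V] [IsProbabilityMeasure ν]
    (E : Finset (V × V)) :
    maxKernelDensity ν (doubleEdges E) = maxKernelDensity ν E ^ 2 := by
  have hmp := measurePreserving_sumPiEquivProdPi_symm
    (fun _ : V ⊕ V => ν.prod (volume : Measure I))
  rw [maxKernelDensity, ← hmp.integral_comp', maxKernelDensity, sq, ← integral_prod_mul]
  refine integral_congr_ae (.of_forall fun x => ?_)
  simp only [doubleEdges, MeasurableEquiv.coe_sumPiEquivProdPi_symm, Finset.prod_disjUnion,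
    Finset.prod_map]
  rfl

theorem IsMaxThetaGraph.tendsto_measure_le_abs_sub [Fintype V] [DecidableEq V] [IsProbabilityMeasure P]
    [IsProbabilityMeasure ν] (hG : IsMaxThetaGraph P ν θ G) (E : Finset (V × V))
    (hE : ∀ e ∈ E, e.swap ∉ E) {ε : ℝ} (hε : 0 < ε) :
    Tendsto (fun n => P {ω | ε ≤ |mapDensity E (G ω) n - maxKernelDensity ν E|}) atTop (𝓝 0) := by
  set L := maxKernelDensity ν E
  have h1 := hG.tendsto_integral_mapDensity E hE
  have h2 := hG.tendsto_integral_mapDensity _ (swap_notMem_doubleEdges hE)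
  simp only [maxKernelDensity_doubleEdges, mapDensity_doubleEdges] at h2
  have hm n := hG.measurable_mapDensity E n
  have hb (n ω) : ‖mapDensity E (G ω) n‖ ≤ 1 := by
    have := mapDensity_mem_Icc E (G ω) n
    rw [Real.norm_of_nonneg this.1]
    exact this.2
  have i1 n : Integrable (fun ω => mapDensity E (G ω) n) P :=
    .of_bound (hm n).aestronglyMeasurable 1 (.of_forall (hb n))
  have i2 n : Integrable (fun ω => mapDensity E (G ω) n ^ 2) P :=
    .of_bound ((hm n).pow_const 2).aestronglyMeasurable 1
      (.of_forall fun ω => by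
        rw [norm_pow]
        exact pow_le_one₀ (norm_nonneg _) (hb n ω))
  -- The second moment is taken about the limit `L` rather than the mean; it tends to `L ^ 2 - 2 * L
  -- * L + L ^ 2 = 0`.
  have hvar n : ∫ ω, (mapDensity E (G ω) n - L) ^ 2 ∂P =
      ∫ ω, mapDensity E (G ω) n ^ 2 ∂P - 2 * L * ∫ ω, mapDensity E (G ω) n ∂P + L ^ 2 := by
    have : (fun ω => (mapDensity E (G ω) n - L) ^ 2) = fun ω =>
        mapDensity E (G ω) n ^ 2 - 2 * L * mapDensity E (G ω) n + L ^ 2 := by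
      ext ω
      ring
    rw [this, integral_add (by exact (i2 n).sub ((i1 n).const_mul _)) (integrable_const _),
      integral_sub (i2 n) ((i1 n).const_mul _), integral_const_mul]
    simp
  have hlim : Tendsto (fun n => (∫ ω, (mapDensity E (G ω) n - L) ^ 2 ∂P) / ε ^ 2) atTop (𝓝 0) := by
    simp only [hvar]
    have := ((h2.sub (h1.const_mul (2 * L))).add_const (L ^ 2)).div_const (ε ^ 2)
    convert this using 2
    simp only [L]
    ring
  have hi n : Integrable (fun ω => (mapDensity E (G ω) n - L) ^ 2) P := by
    have := ((i2 n).sub ((i1 n).const_mul (2 * L))).add (integrable_const (L ^ 2))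
    refine this.congr (.of_forall fun ω => ?_)
    simp only [Pi.add_apply, Pi.sub_apply]
    ring
  have hreal : Tendsto (fun n => P.real {ω | ε ≤ |mapDensity E (G ω) n - L|}) atTop (𝓝 0) := by
    refine squeeze_zero (fun n => measureReal_nonneg) (fun n => ?_) hlim
    rw [le_div_iff₀ (by positivity), mul_comm]
    have hcheb := mul_meas_ge_le_integral_of_nonneg
      (.of_forall fun ω => sq_nonneg (mapDensity E (G ω) n - L)) (hi n) (ε ^ 2)
    have (x : ℝ) : ε ^ 2 ≤ x ^ 2 ↔ ε ≤ |x| := by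
      rw [← sq_abs x, sq_le_sq₀ hε.le (abs_nonneg _)]
    simpa only [this] using hcheb
  simpa [measureReal_def] using
    (ENNReal.tendsto_toReal_iff (fun n => measure_ne_top P _) ENNReal.zero_ne_top).1
      (by simpa [measureReal_def] using hreal)

end Moments
/-! ### Homomorphism densities -/

open Classical in
/-- The edges of a finite graph, as pairs `i < j`. -/
noncomputable def FinGraph.edgePairs (F : FinGraph) : Finset (Fin F.order × Fin F.order) :=
  {e | e.1 < e.2 ∧ F.2.Adj e.1 e.2}

theorem FinGraph.swap_notMem_edgePairs (F : FinGraph) :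
    ∀ e ∈ F.edgePairs, e.swap ∉ F.edgePairs := by
  intro e he he'
  simp only [edgePairs, Finset.mem_filter_univ, Prod.fst_swap, Prod.snd_swap] at he he'
  exact he.1.not_gt he'.1

theorem homDensity_initialGraph (F : FinGraph) (H : SimpleGraph ℕ) (n : ℕ) :
    homDensity F (initialGraph H n) = mapDensity F.edgePairs H n := by
  classical
  have e : (F.2 →g (initialGraph H n).2) ≃
      {φ : Fin F.order → Fin (n + 1) // ∀ e ∈ F.edgePairs, H.Adj (φ e.1) (φ e.2)} :=
    { toFun f := ⟨f, fun e he => f.map_rel (Finset.mem_filter.1 he).2.2⟩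
      invFun φ := ⟨φ.1, fun {a b} hab => by
        rcases lt_or_gt_of_ne hab.ne with h | h
        · exact φ.2 (a, b) (Finset.mem_filter.2 ⟨Finset.mem_univ _, h, hab⟩)
        · exact (φ.2 (b, a) (Finset.mem_filter.2 ⟨Finset.mem_univ _, h, hab.symm⟩)).symm⟩
      left_inv _ := rfl
      right_inv _ := rfl }
  have hcard : Nat.card (Fin F.order → Fin (initialGraph H n).order) = (n + 1) ^ F.order := by
    simp [initialGraph, FinGraph.order]
  rw [homDensity, mapDensity, Nat.card_congr e, hcard, Nat.card_eq_fintype_card,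
    Fintype.card_subtype, Finset.sum_boole, Fintype.card_fin]
  push_cast
  congr!

theorem maxKernel_density (ν : Measure I) (F : FinGraph) :
    maxKernel.density (ν.prod volume) F = maxKernelDensity ν F.edgePairs := rfl

/-! ### Convergence in probability as convergence along a filter -/

/-- The filter on `ℕ × Ω` along which a sequence of random elements converges if and only if it
converges in probability. -/
def probabilityFilter {Ω : Type*} [MeasurableSpace Ω] (P : Measure Ω) : Filter (ℕ × Ω) where
  sets := {S | Tendsto (fun n => P {ω | (n, ω) ∉ S}) atTop (𝓝 0)}
  univ_sets := by simp
  sets_of_superset {S T} hS hST :=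
    tendsto_of_tendsto_of_tendsto_of_le_of_le tendsto_const_nhds hS (fun _ => zero_le)
      fun _ => measure_mono fun _ h h' => h (hST h')
  inter_sets {S T} hS hT := by
    have h := Tendsto.add hS hT
    rw [add_zero] at h
    refine tendsto_of_tendsto_of_tendsto_of_le_of_le tendsto_const_nhds h (fun _ => zero_le)
      fun n => (measure_mono fun ω hω => ?_).trans (measure_union_le _ _)
    simpa [or_iff_not_imp_left] using hω

theorem mem_probabilityFilter {Ω : Type*} [MeasurableSpace Ω] {P : Measure Ω}
    {S : Set (ℕ × Ω)} :
    S ∈ probabilityFilter P ↔ Tendsto (fun n => P {ω | (n, ω) ∉ S}) atTop (𝓝 0) := Iff.rfl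

/-- The filter is nontrivial because the total mass 1 does not tend to 0. This is needed to conclude
that a limit along it lies in a closure. -/
instance {Ω : Type*} [MeasurableSpace Ω] (P : Measure Ω) [IsProbabilityMeasure P] :
    (probabilityFilter P).NeBot := by
  refine ⟨mt empty_mem_iff_bot.2 ?_⟩
  simp [mem_probabilityFilter]

theorem tendsto_fst_probabilityFilter {Ω : Type*} [MeasurableSpace Ω] (P : Measure Ω) :
    Tendsto Prod.fst (probabilityFilter P) atTop := by
  refine tendsto_atTop.2 fun m => ?_
  refine mem_probabilityFilter.2 (tendsto_const_nhds.congr' ?_)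
  filter_upwards [eventually_ge_atTop m] with n hn
  simp [hn]

theorem IsMaxThetaGraph.tendsto_graphPoint {Ω : Type*} [MeasurableSpace Ω] {P : Measure Ω}
    [IsProbabilityMeasure P] {ν : Measure I} [IsProbabilityMeasure ν] {θ : ℕ → Ω → I}
    {G : Ω → SimpleGraph ℕ} (hG : IsMaxThetaGraph P ν θ G) :
    Tendsto (fun p : ℕ × Ω => graphPoint (initialGraph (G p.2) p.1)) (probabilityFilter P)
      (𝓝 (fun F => maxKernel.density (ν.prod volume) F, 0)) := by
  refine Tendsto.prodMk_nhds (tendsto_pi_nhds.2 fun F => ?_) ?_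
  · simp only [homDensity_initialGraph, maxKernel_density]
    refine Metric.tendsto_nhds.2 fun ε hε => mem_probabilityFilter.2 ?_
    simpa [Real.dist_eq] using
      hG.tendsto_measure_le_abs_sub F.edgePairs F.swap_notMem_edgePairs hε
  · have := (tendsto_one_div_add_atTop_nhds_zero_nat (𝕜 := ℝ)).comp
      (tendsto_fst_probabilityFilter P)
    simpa [initialGraph, FinGraph.order, Function.comp_def] using this

theorem theorem5p2 {Ω : Type*} [MeasurableSpace Ω] (P : Measure Ω) [IsProbabilityMeasure P]
    (ν : Measure I) [IsProbabilityMeasure ν]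
    (θ : ℕ → Ω → I) (G : Ω → SimpleGraph ℕ) (hG : IsMaxThetaGraph P ν θ G) :
    ∃ Γ : GraphLimit, Γ.IsRepresentedBy maxKernel (ν.prod (volume : Measure I)) ∧
      ConvergesInProbability P (fun n ω => initialGraph (G ω) n) Γ := by
  have h := hG.tendsto_graphPoint
  -- Existence of the graph limit comes from the convergence itself: the kernel densities, with last
  -- coordinate 0, are a limit of points of finite graphs.
  let Γ : GraphLimit :=
    ⟨⟨_, mem_closure_of_tendsto h (.of_forall fun _ => Set.mem_range_self _)⟩, rfl⟩
  have hΓ : Tendsto (fun p : ℕ × Ω => (initialGraph (G p.2) p.1).toGraphSpace)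
      (probabilityFilter P) (𝓝 (Γ : GraphSpace)) := tendsto_subtype_rng.2 h
  exact ⟨Γ, fun F => rfl, fun U hU => mem_probabilityFilter.1 (hΓ hU)⟩
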